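/- Let $X=\{X_u;u\in[0,1]\}$ be a Brownian bridge on $[0,1]$ from $x$ to $y$ ($x,y\in\mathbb R$), i.e. an almost surely continuous Gaussian process with $\mathrm E[X_u]=(1-u)x+uy$ and $\mathrm{Cov}(X_u,X_v)=u\wedge v-uv$. For $0\le s<t\le 1$ put $m_{s,t}=\inf_{[s,t]}X$ and $M_{s,t}=\sup_{[s,t]}X$. An intersection layer on $[s,t]$ consists of $X_s$, $X_t$ and two intervals $\mathcal L_{s,t}=[L^{\downarrow}_{s,t},L^{\uparrow}_{s,t}]\ni m_{s,t}$ and $\mathcal U_{s,t}=[U^{\downarrow}_{s,t},U^{\uparrow}_{s,t}]\ni M_{s,t}$. The $\varepsilon$-strong algorithm starts from random (measurable) bounded intervals $\mathcal L_{0,1}$, $\mathcal U_{0,1}$ that almost surely contain $m_{0,1}$, $M_{0,1}$ respectively. In each iteration, every current intersection layer, on $[s,t]$ say, is treated as follows. (i) Bisection. Let $t^*=(s+t)/2$, and replace $U^{\downarrow}$ by $U^{\downarrow}\vee X_{t^*}$ and $L^{\uparrow}$ by $L^{\uparrow}\wedge X_{t^*}$. For each half $[a,b]\in\{[s,t^*],[t^*,t]\}$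 set $\mathcal U_{a,b}=[U^{\downarrow},U^{\uparrow}]$ if $M_{a,b}\ge U^{\downarrow}$ and $\mathcal U_{a,b}=[X_a\vee X_b,U^{\downarrow}]$ otherwise; set $\mathcal L_{a,b}=[L^{\downarrow},L^{\uparrow}]$ if $m_{a,b}\le L^{\uparrow}$ and $\mathcal L_{a,b}=[L^{\uparrow},X_a\wedge X_b]$ otherwise. (ii) Refinement. Each of the four new intervals is replaced by the one of its two halves that contains the corresponding extremum, repeatedly, until its width is at most $\sqrt{(t-s)/2}$ (if the extremum is the midpoint, the upper half is taken for a maximum and the lower half for a minimum). After $n$ iterations one has an intersection layer on each of the $2^n$ dyadic intervals $[(i-1)2^{-n},i2^{-n}]$. Define, for $u\in[0,1]$, $$X^{\uparrow}_u(n)=\sum_{i=1}^{2^n}U^{\uparrow}_{(i-1)2^{-n},i2^{-n}}\,\mathrm I_{u\in((i-1)2^{-n},i2^{-n}]},\qquad X^{\downarrow}_u(n)=\sum_{i=1}^{2^n}L^{\downarrow}_{(i-1)2^{-n},i2^{-n}}\,\mathrm I_{u\in((i-1)2^{-n},i2^{-n}]},$$ and $|X^{\uparrow}(n)-X^{\downarrow}(n)|_1=\int_0^1|X^{\uparrow}_u(n)-X^{\downarrow}_u(n)|\,\mathrm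 du$. Then $|X^{\uparrow}(n)-X^{\downarrow}(n)|_1$ is integrable for every $n\ge 1$, and $$2^{n/2}\,\mathrm E\big[|X^{\uparrow}(n)-X^{\downarrow}(n)|_1\big]=\mathcal O(1)\qquad(n\to\infty).$$ -/

import Mathlib

open MeasureTheory ProbabilityTheory Filter Set Asymptotics

namespace EpsStrong

/-- `X`, restricted to the times in `[0,1]`, is a Brownian bridge on `[0,1]` from `x` to `y`:
a Gaussian process with mean `(1 - u) x + u y` and covariance `min u v - u v`, whose paths are
almost surely continuous. The values of `X` at times outside `[0,1]` play no role. -/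
structure IsBrownianBridge {Ω : Type*} [MeasurableSpace Ω] (X : ℝ → Ω → ℝ) (x y : ℝ)
    (P : Measure Ω) : Prop where
  gaussian : IsGaussianProcess (fun u : Icc (0 : ℝ) 1 => X u) P
  mean : ∀ u ∈ Icc (0 : ℝ) 1, ∫ ω, X u ω ∂P = (1 - u) * x + u * y
  covariance : ∀ u ∈ Icc (0 : ℝ) 1, ∀ v ∈ Icc (0 : ℝ) 1, cov[X u, X v; P] = min u v - u * v
  continuous : ∀ᵐ ω ∂P, ContinuousOn (fun u => X u ω) (Icc 0 1)

/-- The minimum of the path `w` over `[s,t]`. -/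
noncomputable def pathMin (w : ℝ → ℝ) (s t : ℝ) : ℝ := sInf (w '' Icc s t)

/-- The maximum of the path `w` over `[s,t]`. -/
noncomputable def pathMax (w : ℝ → ℝ) (s t : ℝ) : ℝ := sSup (w '' Icc s t)

/-- A layer `(a, b)` stands for the interval `[a, b]`. -/
abbrev Layer : Type := ℝ × ℝ

/-- The width `b - a` of the layer `[a, b]`. -/
def Layer.width (J : Layer) : ℝ := J.2 - J.1

/-- The intersection layer of a path on `[s,t]`: the values `X_s`, `X_t`, a layer `lower`
for the minimum and a layer `upper` for the maximum of the path on `[s,t]`. -/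
structure IntersectionLayer where
  xs : ℝ
  xt : ℝ
  lower : Layer
  upper : Layer

/-- One refinement of a layer for the minimum: decide in which half of the layer the
minimum `m` lies. -/
noncomputable def refineLower (m : ℝ) (J : Layer) : Layer :=
  if m ≤ (J.1 + J.2) / 2 then (J.1, (J.1 + J.2) / 2) else ((J.1 + J.2) / 2, J.2)

/-- One refinement of a layer for the maximum: decide in which half of the layer the
maximum `M` lies. -/
noncomputable def refineUpper (M : ℝ) (J : Layer) : Layer :=
  if (J.1 + J.2) / 2 ≤ M then ((J.1 + J.2) / 2, J.2) else (J.1, (J.1 + J.2) / 2)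

/-- Repeat the refinement `step` until the width of the layer is at most `δ` (that is, the least
number of times after which this is so). -/
noncomputable def refineUntil (step : Layer → Layer) (δ : ℝ) (J : Layer) : Layer :=
  step^[sInf {k : ℕ | (step^[k] J).width ≤ δ}] J

/-- Refine the intersection layer `I` of the path `w` on `[s,t]` until both of its layers have
width at most `δ`. -/
noncomputable def refine (w : ℝ → ℝ) (s t δ : ℝ) (I : IntersectionLayer) : IntersectionLayer where
  xs := I.xs
  xt := I.xt
  lower := refineUntil (refineLower (pathMin w s t)) δ I.lower
  upper := refineUntil (refineUpper (pathMax w s t)) δ I.upper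

/-- Bisection of the intersection layer `I` of the path `w` on `[s,t]` at the midpoint `c`:
first `U↓` is replaced by `U↓ ∨ X_c` and `L↑` by `L↑ ∧ X_c`; then, for each of the two halves
of the time interval, it is decided whether the minimum lies in `[L↓, L↑]` or in `[L↑, ·]`, and
whether the maximum lies in `[U↓, U↑]` or in `[·, U↓]`. -/
noncomputable def bisect (w : ℝ → ℝ) (s t : ℝ) (I : IntersectionLayer) :
    IntersectionLayer × IntersectionLayer :=
  let c := (s + t) / 2
  let Ldn := I.lower.1
  let Lup := min I.lower.2 (w c)
  let Udn := max I.upper.1 (w c)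
  let Uup := I.upper.2
  (⟨I.xs, w c,
      if pathMin w s c ≤ Lup then (Ldn, Lup) else (Lup, min I.xs (w c)),
      if Udn ≤ pathMax w s c then (Udn, Uup) else (max I.xs (w c), Udn)⟩,
    ⟨w c, I.xt,
      if pathMin w c t ≤ Lup then (Ldn, Lup) else (Lup, min (w c) I.xt),
      if Udn ≤ pathMax w c t then (Udn, Uup) else (max (w c) I.xt, Udn)⟩)

/-- The `ε`-strong algorithm run on the path `w` with initial layers `L₀` (for the minimum over
`[0,1]`) and `U₀` (for the maximum): `layers w L₀ U₀ n j`, for `j < 2 ^ n`, is the intersection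
layer on `[j 2⁻ⁿ, (j + 1) 2⁻ⁿ]` after `n` iterations. In an iteration every intersection layer,
on `[s,t]` say, is bisected, and the two results are refined until the widths of their layers
are at most `√((t - s) / 2)`. -/
noncomputable def layers (w : ℝ → ℝ) (L₀ U₀ : Layer) : ℕ → ℕ → IntersectionLayer
  | 0, _ => ⟨w 0, w 1, L₀, U₀⟩
  | n + 1, j =>
    let s : ℝ := (j / 2 : ℕ) / 2 ^ n
    let t : ℝ := ((j / 2 : ℕ) + 1) / 2 ^ n
    let c : ℝ := (s + t) / 2
    let B := bisect w s t (layers w L₀ U₀ n (j / 2))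
    if j % 2 = 0 then refine w s c (√((t - s) / 2)) B.1
    else refine w c t (√((t - s) / 2)) B.2

/-- The upper dominating process after `n` iterations, at time `u`. -/
noncomputable def upperProc (w : ℝ → ℝ) (L₀ U₀ : Layer) (n : ℕ) (u : ℝ) : ℝ :=
  ∑ j ∈ Finset.range (2 ^ n),
    (Ioc ((j : ℝ) / 2 ^ n) (((j : ℝ) + 1) / 2 ^ n)).indicator
      (fun _ => (layers w L₀ U₀ n j).upper.2) u

/-- The lower dominating process after `n` iterations, at time `u`. -/
noncomputable def lowerProc (w : ℝ → ℝ) (L₀ U₀ : Layer) (n : ℕ) (u : ℝ) : ℝ :=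
  ∑ j ∈ Finset.range (2 ^ n),
    (Ioc ((j : ℝ) / 2 ^ n) (((j : ℝ) + 1) / 2 ^ n)).indicator
      (fun _ => (layers w L₀ U₀ n j).lower.1) u

/-- The `L¹` distance on `[0,1]` between the two dominating processes after `n` iterations. -/
noncomputable def distL1 (w : ℝ → ℝ) (L₀ U₀ : Layer) (n : ℕ) : ℝ :=
  ∫ u in (0 : ℝ)..1, |upperProc w L₀ U₀ n u - lowerProc w L₀ U₀ n u|

end EpsStrong

/-! After `n ≥ 1` iterations every layer contains its extremum and has width at most `2^(-n/2)`,
whatever the path and the initial layers (`layers_encloses`, `width_layers_le`). Hence on each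
dyadic interval the gap between the dominating processes is at most the oscillation `M - m` of the
path plus `2 * 2^(-n/2)`. The initial layers drop out of the bound, so no moment condition on them
is needed.

It remains to bound the expected oscillation over an interval of length `h` by `C √h`, uniformly in
the position of the interval. Increments of the bridge are Gaussian with mean `O(h)` and variance at
most `h`, so their fourth moments are `O(h²)`. Dyadic chaining turns this into the oscillation bound
(`exists_lintegral_oscillation_le`); the law of the extrema is never used. Averaging over `2^n`
intervals with `h = 2^(-n)` gives the rate.

Expectations are estimated as `ENNReal`-valued integrals, which need no prior integrability.
Measurability of the random layers is proved separately; together with the bound it gives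
integrability. -/

namespace EpsStrong

/-! ### Oscillation of a process by dyadic chaining -/

lemma abs_le_add_pow_four_div (a : ℝ) {l : ℝ} (hl : 0 < l) : |a| ≤ l + a ^ 4 / l ^ 3 := by
  have h4 : a ^ 4 = |a| ^ 4 := by rw [← abs_pow, abs_of_nonneg (by positivity)]
  rw [h4]
  rcases le_total |a| l with h | h
  · have : 0 ≤ |a| ^ 4 / l ^ 3 := by positivity
    linarith
  -- Above the threshold, `l ^ 3 ≤ |a| ^ 3`.
  · have : |a| ≤ |a| ^ 4 / l ^ 3 := by
      rw [le_div_iff₀ (by positivity), pow_succ' |a| 3]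
      gcongr
    linarith

/-- Chaining along the dyadic points of an interval. -/
lemma abs_sub_le_sum_of_dyadic {f : ℝ → ℝ} {s h : ℝ} {b : ℕ → ℝ}
    (hb : ∀ k i : ℕ, i < 2 ^ k →
      |f (s + (i + 1 : ℕ) * h / 2 ^ k) - f (s + i * h / 2 ^ k)| ≤ b k) (k : ℕ) :
    ∀ i : ℕ, i ≤ 2 ^ k →
      |f (s + i * h / 2 ^ k) - f s| ≤ ∑ l ∈ Finset.range (k + 1), b l := by
  have hb0 : ∀ k, 0 ≤ b k := fun k => (abs_nonneg _).trans (hb k 0 (by positivity))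
  induction k with
  | zero =>
    intro i hi
    have hi' : i = 0 ∨ i = 1 := by simp at hi; omega
    rcases hi' with rfl | rfl
    · simpa using hb0 0
    · simpa using hb 0 0 (by simp)
  | succ k ih =>
    have heven : ∀ j : ℕ, s + (2 * j : ℕ) * h / 2 ^ (k + 1) = s + j * h / 2 ^ k := by
      intro j
      push_cast
      rw [pow_succ]
      field_simp
    intro i hi
    rw [Finset.sum_range_succ]
    -- An even point of level `k + 1` already belongs to level `k`; an odd one is a single level-`k
    -- + 1` step away from such a point.
    rcases Nat.even_or_odd' i with ⟨j, rfl | rfl⟩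
    · rw [heven]
      have := ih j (by rw [pow_succ] at hi; omega)
      linarith [hb0 (k + 1)]
    · have h1 := ih j (by rw [pow_succ] at hi; omega)
      have h2 := hb (k + 1) (2 * j) (by omega)
      rw [heven] at h2
      have := abs_sub_le (f (s + (2 * j + 1 : ℕ) * h / 2 ^ (k + 1))) (f (s + j * h / 2 ^ k)) (f s)
      linarith

/-- The dyadic points `⌊v 2^k⌋ / 2^k` converge to the relative position `v` of `u`, so by continuity
the chaining bound passes to the limit. In `ENNReal` the series needs no summability. -/
lemma ofReal_abs_sub_le_tsum_of_dyadic {f : ℝ → ℝ} {s h : ℝ} (hh : 0 < h) {b : ℕ → ℝ}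
    (hf : ContinuousOn f (Icc s (s + h)))
    (hb : ∀ k i : ℕ, i < 2 ^ k →
      |f (s + (i + 1 : ℕ) * h / 2 ^ k) - f (s + i * h / 2 ^ k)| ≤ b k)
    {u : ℝ} (hu : u ∈ Icc s (s + h)) :
    ENNReal.ofReal |f u - f s| ≤ ∑' k, ENNReal.ofReal (b k) := by
  have hb0 : ∀ k, 0 ≤ b k := fun k => (abs_nonneg _).trans (hb k 0 (by positivity))
  obtain ⟨v, rfl⟩ : ∃ v, u = s + v * h := ⟨(u - s) / h, by field_simp; ring⟩
  have hv0 : 0 ≤ v := by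
    by_contra! hc
    nlinarith [hu.1]
  have hv1 : v ≤ 1 := by
    by_contra! hc
    nlinarith [hu.2]
  have hfl : ∀ k : ℕ, ⌊v * 2 ^ k⌋₊ ≤ 2 ^ k := fun k => by
    have : (⌊v * 2 ^ k⌋₊ : ℝ) ≤ 2 ^ k :=
      (Nat.floor_le (by positivity)).trans (mul_le_of_le_one_left (by positivity) hv1)
    exact_mod_cast this
  have hlim : Tendsto (fun k : ℕ => (⌊v * 2 ^ k⌋₊ : ℝ) / 2 ^ k) atTop (nhds v) :=
    (tendsto_nat_floor_mul_div_atTop hv0).comp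
      (tendsto_pow_atTop_atTop_of_one_lt (one_lt_two (α := ℝ)))
  have hlim2 : Tendsto (fun k : ℕ => s + (⌊v * 2 ^ k⌋₊ : ℝ) * h / 2 ^ k) atTop
      (nhdsWithin (s + v * h) (Icc s (s + h))) := by
    refine tendsto_nhdsWithin_iff.2 ⟨?_, Eventually.of_forall fun k => ?_⟩
    · refine ((hlim.mul_const h).const_add s).congr fun k => ?_
      ring
    · have h1 : (⌊v * 2 ^ k⌋₊ : ℝ) / 2 ^ k ≤ 1 := by
        rw [div_le_one (by positivity)]
        exact_mod_cast hfl k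
      have h2 : (⌊v * 2 ^ k⌋₊ : ℝ) * h / 2 ^ k = (⌊v * 2 ^ k⌋₊ : ℝ) / 2 ^ k * h := by ring
      rw [h2]
      constructor
      · have : 0 ≤ (⌊v * 2 ^ k⌋₊ : ℝ) / 2 ^ k * h := by positivity
        linarith
      · nlinarith
  have hlim3 := (hf (s + v * h) hu).tendsto.comp hlim2
  have hlim4 := (ENNReal.continuous_ofReal.tendsto _).comp ((hlim3.sub_const (f s)).abs)
  refine le_of_tendsto hlim4 (Eventually.of_forall fun k => ?_)
  calc ENNReal.ofReal |f (s + (⌊v * 2 ^ k⌋₊ : ℝ) * h / 2 ^ k) - f s|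
      ≤ ENNReal.ofReal (∑ l ∈ Finset.range (k + 1), b l) :=
        ENNReal.ofReal_le_ofReal (abs_sub_le_sum_of_dyadic hb k _ (hfl k))
    _ = ∑ l ∈ Finset.range (k + 1), ENNReal.ofReal (b l) :=
        ENNReal.ofReal_sum_of_nonneg fun l _ => hb0 l
    _ ≤ _ := ENNReal.sum_le_tsum _

/-- A process with continuous paths on `[0,1]` whose increments have fourth moments of the order
of the square of the time step has, on every interval of length `h`, an expected oscillation of
order `√h`. -/
lemma exists_lintegral_oscillation_le {Ω : Type*} [MeasurableSpace Ω] {P : Measure Ω}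
    [IsProbabilityMeasure P] {X : ℝ → Ω → ℝ} {K : ℝ} (hK : 0 ≤ K)
    (hmeas : ∀ u ∈ Icc (0 : ℝ) 1, AEMeasurable (X u) P)
    (hcont : ∀ᵐ ω ∂P, ContinuousOn (fun u => X u ω) (Icc 0 1))
    (hmom : ∀ s t : ℝ, 0 ≤ s → s ≤ t → t ≤ 1 →
      ∫⁻ ω, ENNReal.ofReal ((X t ω - X s ω) ^ 4) ∂P ≤ ENNReal.ofReal (K * (t - s) ^ 2)) :
    ∃ C : ℝ, 0 ≤ C ∧ ∀ s h : ℝ, 0 ≤ s → 0 < h → s + h ≤ 1 → ∃ G : Ω → ENNReal,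
      AEMeasurable G P ∧ ∫⁻ ω, G ω ∂P ≤ ENNReal.ofReal (C * √h) ∧
      ∀ᵐ ω ∂P, ∀ u ∈ Icc s (s + h), ENNReal.ofReal |X u ω - X s ω| ≤ G ω := by
  have hs1 : Summable fun k : ℕ => (9 / 10 : ℝ) ^ k :=
    summable_geometric_of_lt_one (by norm_num) (by norm_num)
  have hs2 : Summable fun k : ℕ => K * (500 / 729 : ℝ) ^ k :=
    (summable_geometric_of_lt_one (by norm_num) (by norm_num)).mul_left K
  -- The threshold at level `k` is `√h r^k` with `r = 9/10`. The two terms are the threshold and the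
  -- fourth-moment cost, whose ratio is `1 / (2 r³) = 500/729`; any `r < 1` with `2 r³ > 1` would
  -- do.
  refine ⟨∑' k : ℕ, ((9 / 10 : ℝ) ^ k + K * (500 / 729 : ℝ) ^ k),
    tsum_nonneg fun k => by positivity, fun s h hs hh hsh => ?_⟩
  set q := √h with hq
  have hq0 : 0 < q := Real.sqrt_pos.2 hh
  have hqh : q ^ 2 = h := Real.sq_sqrt hh.le
  set l : ℕ → ℝ := fun k => q * (9 / 10) ^ k with hl
  have hl0 : ∀ k, 0 < l k := fun k => by positivity
  set D : ℕ → ℕ → Ω → ℝ := fun k i ω =>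
    (X (s + (i + 1 : ℕ) * h / 2 ^ k) ω - X (s + i * h / 2 ^ k) ω) ^ 4 with hD
  have hD0 : ∀ k i ω, 0 ≤ D k i ω := fun k i ω => by
    rw [hD]
    positivity
  -- The maximum of the `2^k` increments of a level is replaced by a sum only in the fourth-power
  -- part, so the threshold is paid once per level.
  set b : ℕ → Ω → ℝ := fun k ω => l k + ∑ i ∈ Finset.range (2 ^ k), D k i ω / l k ^ 3 with hb
  have hpt : ∀ k i : ℕ, i ≤ 2 ^ k → s + i * h / 2 ^ k ∈ Icc 0 1 := by
    intro k i hi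
    have h1 : (i : ℝ) / 2 ^ k ≤ 1 := by
      rw [div_le_one (by positivity)]
      exact_mod_cast hi
    have h2 : (i : ℝ) * h / 2 ^ k = i / 2 ^ k * h := by ring
    constructor
    · positivity
    · rw [h2]
      nlinarith
  have hDmeas : ∀ k i : ℕ, i < 2 ^ k → AEMeasurable (D k i) P := fun k i hi =>
    ((hmeas _ (hpt k (i + 1) hi)).sub (hmeas _ (hpt k i hi.le))).pow_const 4
  have hbmeas : ∀ k, AEMeasurable (fun ω => ENNReal.ofReal (b k ω)) P := by
    intro k
    refine AEMeasurable.ennreal_ofReal (AEMeasurable.const_add ?_ _)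
    refine Finset.aemeasurable_fun_sum _ fun i hi => ?_
    exact (hDmeas k i (Finset.mem_range.1 hi)).div_const _
  refine ⟨fun ω => ∑' k, ENNReal.ofReal (b k ω), AEMeasurable.tsum hbmeas, ?_, ?_⟩
  · rw [lintegral_tsum hbmeas, mul_comm, ← tsum_mul_left, ENNReal.ofReal_tsum_of_nonneg
      (fun k => by positivity) ((hs1.add hs2).mul_left q)]
    refine ENNReal.tsum_le_tsum fun k => ?_
    have e1 : ∀ ω, ENNReal.ofReal (b k ω) = ENNReal.ofReal (l k) +
        ∑ i ∈ Finset.range (2 ^ k), ENNReal.ofReal (1 / l k ^ 3) * ENNReal.ofReal (D k i ω) := by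
      intro ω
      have := hl0 k
      rw [hb, ENNReal.ofReal_add this.le
        (Finset.sum_nonneg fun i _ => div_nonneg (hD0 _ _ _) (by positivity)),
        ENNReal.ofReal_sum_of_nonneg fun i _ => div_nonneg (hD0 _ _ _) (by positivity)]
      congr 1
      refine Finset.sum_congr rfl fun i _ => ?_
      rw [← ENNReal.ofReal_mul (by positivity)]
      congr 1
      ring
    simp_rw [e1]
    rw [lintegral_add_left measurable_const, lintegral_const, measure_univ, mul_one,
      lintegral_finsetSum' _ fun i hi =>
        ((hDmeas k i (Finset.mem_range.1 hi)).ennreal_ofReal).const_mul _]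
    have e2 : ∀ i ∈ Finset.range (2 ^ k),
        ∫⁻ ω, ENNReal.ofReal (1 / l k ^ 3) * ENNReal.ofReal (D k i ω) ∂P ≤
          ENNReal.ofReal (1 / l k ^ 3 * (K * (h / 2 ^ k) ^ 2)) := by
      intro i hi
      have hi' := Finset.mem_range.1 hi
      have := hl0 k
      rw [lintegral_const_mul' _ _ ENNReal.ofReal_ne_top, ENNReal.ofReal_mul (by positivity)]
      gcongr
      have e3 : s + (i + 1 : ℕ) * h / 2 ^ k - (s + i * h / 2 ^ k) = h / 2 ^ k := by
        push_cast
        ring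
      have := hmom (s + i * h / 2 ^ k) (s + (i + 1 : ℕ) * h / 2 ^ k) (hpt k i hi'.le).1
        (by rw [← sub_nonneg, e3]; positivity) (hpt k (i + 1) hi').2
      rwa [e3] at this
    refine (add_le_add_right (Finset.sum_le_sum e2) _).trans (le_of_eq ?_)
    have := hl0 k
    rw [Finset.sum_const, Finset.card_range, nsmul_eq_mul, ← ENNReal.ofReal_natCast,
      ← ENNReal.ofReal_mul (by positivity), ← ENNReal.ofReal_add this.le (by positivity)]
    congr 1
    have e4 : (500 / 729 : ℝ) ^ k = 1 / (2 ^ k * ((9 / 10) ^ k) ^ 3) := by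
      rw [← pow_mul, mul_comm k 3, pow_mul, ← mul_pow, one_div, ← inv_pow]
      norm_num
    rw [e4, hl, ← hqh]
    push_cast
    field_simp
  · filter_upwards [hcont] with ω hω u hu
    refine ofReal_abs_sub_le_tsum_of_dyadic (f := fun u => X u ω) (b := fun k => b k ω) hh
      (hω.mono (Icc_subset_Icc hs hsh)) (fun k i hi => ?_) hu
    refine (abs_le_add_pow_four_div _ (hl0 k)).trans ?_
    rw [hb]
    have := hl0 k
    have := Finset.single_le_sum (f := fun i => D k i ω / l k ^ 3)
      (fun i _ => div_nonneg (hD0 k i ω) (by positivity)) (Finset.mem_range.2 hi)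
    simpa [hD] using this

/-- The fourth moment of a real Gaussian variable. -/
lemma exists_lintegral_pow_four_gaussianReal_le :
    ∃ K : ℝ, 0 ≤ K ∧ ∀ (m : ℝ) (v : NNReal),
      ∫⁻ z, ENNReal.ofReal (z ^ 4) ∂(gaussianReal m v) ≤
        ENNReal.ofReal (8 * m ^ 4 + K * (v : ℝ) ^ 2) := by
  have hint : Integrable (fun z : ℝ => z ^ 4) (gaussianReal 0 1) := by
    have := (memLp_id_gaussianReal (μ := 0) (v := 1) 4).integrable_norm_pow (by norm_num)
    refine this.congr (Eventually.of_forall fun z => ?_)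
    simp [← abs_pow, abs_of_nonneg (show (0 : ℝ) ≤ z ^ 4 by positivity)]
  have h0 : 0 ≤ ∫ z, z ^ 4 ∂(gaussianReal 0 1) := integral_nonneg fun z => by positivity
  refine ⟨8 * ∫ z, z ^ 4 ∂(gaussianReal 0 1), by positivity, fun m v => ?_⟩
  have hmap : gaussianReal m v =
      (gaussianReal 0 1).map (fun z => m + √(v : ℝ) * z) := by
    have h1 : (fun z : ℝ => m + √(v : ℝ) * z) = (fun z => m + z) ∘ (fun z => √(v : ℝ) * z) := rfl
    rw [h1, ← Measure.map_map (by fun_prop) (by fun_prop), gaussianReal_map_const_mul,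
      gaussianReal_map_const_add]
    congr 1
    · simp
    · ext
      simp
  rw [hmap, lintegral_map (by fun_prop) (by fun_prop)]
  -- Convexity of the fourth power: `(m + a)^4 ≤ 8 (m^4 + a^4)`.
  have hle : ∀ z : ℝ, (m + √(v : ℝ) * z) ^ 4 ≤ 8 * m ^ 4 + 8 * (v : ℝ) ^ 2 * z ^ 4 := by
    intro z
    have hv : (v : ℝ) ^ 2 * z ^ 4 = (√(v : ℝ) * z) ^ 4 := by
      have h2 : √(v : ℝ) ^ 4 = (√(v : ℝ) ^ 2) ^ 2 := by ring
      rw [mul_pow, h2, Real.sq_sqrt v.coe_nonneg]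
    rw [mul_assoc, hv]
    generalize √(v : ℝ) * z = a
    have h1 := add_sq_le (a := m) (b := a)
    have h2 := add_sq_le (a := m ^ 2) (b := a ^ 2)
    nlinarith [sq_nonneg (m + a)]
  refine (lintegral_mono fun z => ENNReal.ofReal_le_ofReal (hle z)).trans (le_of_eq ?_)
  have hc : Integrable (fun _ : ℝ => 8 * m ^ 4) (gaussianReal 0 1) := integrable_const _
  have hz : Integrable (fun z : ℝ => 8 * (v : ℝ) ^ 2 * z ^ 4) (gaussianReal 0 1) :=
    hint.const_mul _
  have hsum : Integrable (fun z : ℝ => 8 * m ^ 4 + 8 * (v : ℝ) ^ 2 * z ^ 4)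
    (gaussianReal 0 1) := hc.add hz
  rw [← ofReal_integral_eq_lintegral_ofReal hsum (Eventually.of_forall fun z => by positivity),
    integral_add hc hz, integral_const, integral_const_mul]
  congr 1
  simp
  ring

end EpsStrong

namespace EpsStrong

/-! ### Increments of the Brownian bridge -/

section Bridge

variable {Ω : Type*} [MeasurableSpace Ω] {P : Measure Ω} {X : ℝ → Ω → ℝ} {x y : ℝ}

lemma IsBrownianBridge.aemeasurable (hX : IsBrownianBridge X x y P) {u : ℝ}
    (hu : u ∈ Icc (0 : ℝ) 1) : AEMeasurable (X u) P :=
  hX.gaussian.aemeasurable ⟨u, hu⟩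

/-- The law of the increments of a Brownian bridge. -/
lemma IsBrownianBridge.map_sub (hX : IsBrownianBridge X x y P)
    {s t : ℝ} (hs : 0 ≤ s) (hst : s ≤ t) (ht : t ≤ 1) :
    P.map (fun ω => X t ω - X s ω) =
      gaussianReal ((t - s) * (y - x)) ((t - s) - (t - s) ^ 2).toNNReal := by
  have : IsProbabilityMeasure P := hX.gaussian.isProbabilityMeasure
  have hs' : s ∈ Icc (0 : ℝ) 1 := ⟨hs, hst.trans ht⟩
  have ht' : t ∈ Icc (0 : ℝ) 1 := ⟨hs.trans hst, ht⟩
  have hG : HasGaussianLaw (fun ω => X t ω - X s ω) P :=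
    hX.gaussian.hasGaussianLaw_fun_sub (s := ⟨t, ht'⟩) (t := ⟨s, hs'⟩)
  have hGs : HasGaussianLaw (X s) P := hX.gaussian.hasGaussianLaw_eval ⟨s, hs'⟩
  have hGt : HasGaussianLaw (X t) P := hX.gaussian.hasGaussianLaw_eval ⟨t, ht'⟩
  rw [hG.map_eq_gaussianReal, integral_sub hGt.integrable hGs.integrable, hX.mean t ht',
    hX.mean s hs', variance_fun_sub hGt.memLp_two hGs.memLp_two,
    ← covariance_self hGt.aemeasurable, ← covariance_self hGs.aemeasurable,
    hX.covariance t ht' t ht', hX.covariance t ht' s hs', hX.covariance s hs' s hs',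
    min_self, min_self, min_eq_right hst]
  congr 1
  · ring
  · congr 1
    ring

/-- With `d = t - s ≤ 1`, the drift contributes `(d (y - x))^4 ≤ (y - x)^4 d²`, and the variance `d
- d²` is at most `d`. -/
lemma IsBrownianBridge.exists_lintegral_sub_pow_four_le (hX : IsBrownianBridge X x y P) :
    ∃ K : ℝ, 0 ≤ K ∧ ∀ s t : ℝ, 0 ≤ s → s ≤ t → t ≤ 1 →
      ∫⁻ ω, ENNReal.ofReal ((X t ω - X s ω) ^ 4) ∂P ≤ ENNReal.ofReal (K * (t - s) ^ 2) := by
  obtain ⟨K, hK, h⟩ := exists_lintegral_pow_four_gaussianReal_le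
  refine ⟨8 * (y - x) ^ 4 + K, by positivity, fun s t hs hst ht => ?_⟩
  have hmeas : AEMeasurable (fun ω => X t ω - X s ω) P :=
    (hX.aemeasurable ⟨hs.trans hst, ht⟩).sub (hX.aemeasurable ⟨hs, hst.trans ht⟩)
  have h1 := h ((t - s) * (y - x)) ((t - s) - (t - s) ^ 2).toNNReal
  rw [← hX.map_sub hs hst ht, lintegral_map' (by fun_prop) hmeas] at h1
  refine h1.trans (ENNReal.ofReal_le_ofReal ?_)
  have hd0 : 0 ≤ t - s := by linarith
  have hd1 : t - s ≤ 1 := by linarith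
  generalize t - s = d at hd0 hd1
  have hv : 0 ≤ d - d ^ 2 := by nlinarith
  rw [Real.coe_toNNReal _ hv]
  have h2 : (d * (y - x)) ^ 4 ≤ (y - x) ^ 4 * d ^ 2 := by
    rw [mul_pow, mul_comm]
    have : d ^ 4 ≤ d ^ 2 := pow_le_pow_of_le_one hd0 hd1 (by norm_num)
    gcongr
  have h3 : K * (d - d ^ 2) ^ 2 ≤ K * d ^ 2 := by
    gcongr
    nlinarith
  linarith

end Bridge

/-! ### Extrema of continuous paths and their measurability -/

section PathExtrema

variable {w : ℝ → ℝ} {s t : ℝ}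

lemma pathMax_isLUB (hw : ContinuousOn w (Icc s t)) (hst : s ≤ t) :
    IsLUB (w '' Icc s t) (pathMax w s t) :=
  isLUB_csSup ((nonempty_Icc.2 hst).image w) (isCompact_Icc.image_of_continuousOn hw).bddAbove

lemma pathMin_isGLB (hw : ContinuousOn w (Icc s t)) (hst : s ≤ t) :
    IsGLB (w '' Icc s t) (pathMin w s t) :=
  isGLB_csInf ((nonempty_Icc.2 hst).image w) (isCompact_Icc.image_of_continuousOn hw).bddBelow

lemma le_pathMax (hw : ContinuousOn w (Icc s t)) {u : ℝ} (hu : u ∈ Icc s t) :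
    w u ≤ pathMax w s t :=
  (pathMax_isLUB hw (hu.1.trans hu.2)).1 (mem_image_of_mem w hu)

lemma pathMin_le (hw : ContinuousOn w (Icc s t)) {u : ℝ} (hu : u ∈ Icc s t) :
    pathMin w s t ≤ w u :=
  (pathMin_isGLB hw (hu.1.trans hu.2)).1 (mem_image_of_mem w hu)

lemma exists_eq_pathMax (hw : ContinuousOn w (Icc s t)) (hst : s ≤ t) :
    ∃ u ∈ Icc s t, w u = pathMax w s t :=
  (isCompact_Icc.image_of_continuousOn hw).sSup_mem ((nonempty_Icc.2 hst).image w)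

lemma exists_eq_pathMin (hw : ContinuousOn w (Icc s t)) (hst : s ≤ t) :
    ∃ u ∈ Icc s t, w u = pathMin w s t :=
  (isCompact_Icc.image_of_continuousOn hw).sInf_mem ((nonempty_Icc.2 hst).image w)

lemma pathMax_mono (hw : ContinuousOn w (Icc s t)) {a b : ℝ} (hab : a ≤ b)
    (h : Icc a b ⊆ Icc s t) : pathMax w a b ≤ pathMax w s t := by
  obtain ⟨u, hu, hu'⟩ := exists_eq_pathMax (hw.mono h) hab
  exact hu' ▸ le_pathMax hw (h hu)

lemma pathMin_anti (hw : ContinuousOn w (Icc s t)) {a b : ℝ} (hab : a ≤ b)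
    (h : Icc a b ⊆ Icc s t) : pathMin w s t ≤ pathMin w a b := by
  obtain ⟨u, hu, hu'⟩ := exists_eq_pathMin (hw.mono h) hab
  exact hu' ▸ pathMin_le hw (h hu)

variable {Ω : Type*} [MeasurableSpace Ω] {P : Measure Ω} {X : ℝ → Ω → ℝ}

/-- For a continuous path the supremum over the interval equals the supremum over a countable dense
set, since a bound on a dense set extends to its closure. -/
lemma aemeasurable_pathMax (hst : s ≤ t) (hmeas : ∀ u ∈ Icc s t, AEMeasurable (X u) P)
    (hcont : ∀ᵐ ω ∂P, ContinuousOn (fun u => X u ω) (Icc s t)) :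
    AEMeasurable (fun ω => pathMax (fun u => X u ω) s t) P := by
  have : Nonempty (Icc s t) := ⟨⟨s, left_mem_Icc.2 hst⟩⟩
  refine AEMeasurable.isLUB (f := fun i : ℕ => X (TopologicalSpace.denseSeq (Icc s t) i))
    (fun i => hmeas _ (Subtype.coe_prop _)) ?_
  filter_upwards [hcont] with ω hω
  refine ⟨?_, fun b hb => ?_⟩
  · rintro _ ⟨i, rfl⟩
    exact le_pathMax hω (Subtype.coe_prop _)
  · refine (pathMax_isLUB hω hst).2 ?_
    rintro _ ⟨u, hu, rfl⟩
    refine (TopologicalSpace.denseRange_denseSeq (Icc s t)).induction_on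
      (p := fun v : Icc s t => X v ω ≤ b) ⟨u, hu⟩ ?_ fun i => hb ⟨i, rfl⟩
    exact isClosed_le (continuousOn_iff_continuous_domRestrict.1 hω) continuous_const

lemma aemeasurable_pathMin (hst : s ≤ t) (hmeas : ∀ u ∈ Icc s t, AEMeasurable (X u) P)
    (hcont : ∀ᵐ ω ∂P, ContinuousOn (fun u => X u ω) (Icc s t)) :
    AEMeasurable (fun ω => pathMin (fun u => X u ω) s t) P := by
  have : Nonempty (Icc s t) := ⟨⟨s, left_mem_Icc.2 hst⟩⟩
  refine AEMeasurable.isGLB (f := fun i : ℕ => X (TopologicalSpace.denseSeq (Icc s t) i))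
    (fun i => hmeas _ (Subtype.coe_prop _)) ?_
  filter_upwards [hcont] with ω hω
  refine ⟨?_, fun b hb => ?_⟩
  · rintro _ ⟨i, rfl⟩
    exact pathMin_le hω (Subtype.coe_prop _)
  · refine (pathMin_isGLB hω hst).2 ?_
    rintro _ ⟨u, hu, rfl⟩
    refine (TopologicalSpace.denseRange_denseSeq (Icc s t)).induction_on
      (p := fun v : Icc s t => b ≤ X v ω) ⟨u, hu⟩ ?_ fun i => hb ⟨i, rfl⟩
    exact isClosed_le continuous_const (continuousOn_iff_continuous_domRestrict.1 hω)

end PathExtrema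

/-! ### Refinement of layers by halving -/

section Refinement

lemma width_refineLower (m : ℝ) (J : Layer) : (refineLower m J).width = J.width / 2 := by
  unfold refineLower Layer.width
  split_ifs <;> ring

lemma width_refineUpper (m : ℝ) (J : Layer) : (refineUpper m J).width = J.width / 2 := by
  unfold refineUpper Layer.width
  split_ifs <;> ring

lemma mem_refineLower {m : ℝ} {J : Layer} (h : m ∈ Icc J.1 J.2) :
    m ∈ Icc (refineLower m J).1 (refineLower m J).2 := by
  unfold refineLower
  split_ifs with hm
  · exact ⟨h.1, hm⟩
  · exact ⟨(not_le.1 hm).le, h.2⟩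

lemma mem_refineUpper {m : ℝ} {J : Layer} (h : m ∈ Icc J.1 J.2) :
    m ∈ Icc (refineUpper m J).1 (refineUpper m J).2 := by
  unfold refineUpper
  split_ifs with hm
  · exact ⟨hm, h.2⟩
  · exact ⟨h.1, (not_le.1 hm).le⟩

variable {step : Layer → Layer} {δ : ℝ}

/-- This makes the set in `refineUntil` nonempty. Otherwise its `sInf` would be the default `0` and
the layer would stay unrefined. -/
lemma exists_width_iterate_le (hstep : ∀ J, (step J).width = J.width / 2) (hδ : 0 < δ)
    (J : Layer) : ∃ k : ℕ, (step^[k] J).width ≤ δ := by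
  have h : ∀ k : ℕ, (step^[k] J).width = J.width * (1 / 2) ^ k := by
    intro k
    induction k with
    | zero => simp
    | succ k ih => rw [Function.iterate_succ_apply', hstep, ih, pow_succ]; ring
  have hlim : Tendsto (fun k : ℕ => J.width * (1 / 2 : ℝ) ^ k) atTop (nhds (J.width * 0)) :=
    (tendsto_pow_atTop_nhds_zero_of_lt_one (by norm_num) (by norm_num)).const_mul _
  rw [mul_zero] at hlim
  obtain ⟨k, hk⟩ := (hlim.eventually_le_const hδ).exists
  exact ⟨k, (h k).trans_le hk⟩

lemma width_refineUntil_le (hstep : ∀ J, (step J).width = J.width / 2) (hδ : 0 < δ)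
    (J : Layer) : (refineUntil step δ J).width ≤ δ :=
  Nat.sInf_mem (exists_width_iterate_le hstep hδ J)

lemma mem_refineUntil {m : ℝ} (hstep : ∀ J : Layer, m ∈ Icc J.1 J.2 →
    m ∈ Icc (step J).1 (step J).2) {J : Layer} (h : m ∈ Icc J.1 J.2) :
    m ∈ Icc (refineUntil step δ J).1 (refineUntil step δ J).2 := by
  unfold refineUntil
  generalize sInf {k : ℕ | (step^[k] J).width ≤ δ} = k
  induction k with
  | zero => exact h
  | succ k ih =>
    rw [Function.iterate_succ_apply']
    exact hstep _ ih

lemma measurable_width : Measurable Layer.width := by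
  unfold Layer.width
  fun_prop

/-- The number of halvings depends on the layer and the extremum, but it is the first index
satisfying a measurable condition, so `Measurable.find` applies. -/
lemma measurable_refineUntil {step : ℝ → Layer → Layer}
    (hmeas : Measurable fun p : ℝ × Layer => step p.1 p.2)
    (hstep : ∀ m J, (step m J).width = J.width / 2) (hδ : 0 < δ) :
    Measurable fun p : ℝ × Layer => refineUntil (step p.1) δ p.2 := by
  classical
  have hiter : ∀ k : ℕ, Measurable fun p : ℝ × Layer => (step p.1)^[k] p.2 := by
    intro k
    induction k with
    | zero => exact measurable_snd
    | succ k ih =>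
      simp_rw [Function.iterate_succ_apply']
      exact hmeas.comp (measurable_fst.prodMk ih)
  have hex : ∀ p : ℝ × Layer, ∃ k : ℕ, ((step p.1)^[k] p.2).width ≤ δ :=
    fun p => exists_width_iterate_le (hstep p.1) hδ p.2
  have := Measurable.find hiter
    (fun k => measurableSet_le (measurable_width.comp (hiter k)) measurable_const) hex
  convert this using 2 with p
  have hfind : sInf {k : ℕ | ((step p.1)^[k] p.2).width ≤ δ} = Nat.find (hex p) :=
    le_antisymm (Nat.sInf_le (Nat.find_spec (hex p)))
      (Nat.find_min' (hex p) (Nat.sInf_mem (hex p)))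
  rw [refineUntil, hfind]

lemma measurable_refineLower : Measurable fun p : ℝ × Layer => refineLower p.1 p.2 := by
  unfold refineLower
  exact Measurable.ite (measurableSet_le (by fun_prop) (by fun_prop)) (by fun_prop) (by fun_prop)

lemma measurable_refineUpper : Measurable fun p : ℝ × Layer => refineUpper p.1 p.2 := by
  unfold refineUpper
  exact Measurable.ite (measurableSet_le (by fun_prop) (by fun_prop)) (by fun_prop) (by fun_prop)

end Refinement

/-! ### Enclosure of the extrema under bisection and refinement -/

section Invariants

/-- `I` is an intersection layer of the path `w` on `[s,t]`. -/
structure Encloses (w : ℝ → ℝ) (s t : ℝ) (I : IntersectionLayer) : Prop where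
  xs : I.xs = w s
  xt : I.xt = w t
  lower : pathMin w s t ∈ Icc I.lower.1 I.lower.2
  upper : pathMax w s t ∈ Icc I.upper.1 I.upper.2

variable {w : ℝ → ℝ} {s t δ : ℝ} {I : IntersectionLayer}

lemma Encloses.refine (h : Encloses w s t I) : Encloses w s t (refine w s t δ I) where
  xs := h.xs
  xt := h.xt
  lower := mem_refineUntil (fun _ => mem_refineLower) h.lower
  upper := mem_refineUntil (fun _ => mem_refineUpper) h.upper

/-- On a half interval the minimum is at least the old one and at most both endpoint values. These
supply the outer bound when the test succeeds and the inner bound when it fails; the test itself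
supplies the other one. The maximum is symmetric. -/
lemma Encloses.bisect (hw : ContinuousOn w (Icc s t)) (hst : s ≤ t) (h : Encloses w s t I) :
    Encloses w s ((s + t) / 2) (bisect w s t I).1 ∧
      Encloses w ((s + t) / 2) t (bisect w s t I).2 := by
  have hsc : s ≤ (s + t) / 2 := by linarith
  have hct : (s + t) / 2 ≤ t := by linarith
  have hl : Icc s ((s + t) / 2) ⊆ Icc s t := Icc_subset_Icc_right hct
  have hr : Icc ((s + t) / 2) t ⊆ Icc s t := Icc_subset_Icc_left hsc
  refine ⟨⟨h.xs, rfl, ?_, ?_⟩, ⟨rfl, h.xt, ?_, ?_⟩⟩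
  · dsimp only [EpsStrong.bisect]
    split_ifs with hm
    · exact ⟨h.lower.1.trans (pathMin_anti hw hsc hl), hm⟩
    · exact ⟨(not_le.1 hm).le, h.xs ▸ le_min (pathMin_le (hw.mono hl) (left_mem_Icc.2 hsc))
        (pathMin_le (hw.mono hl) (right_mem_Icc.2 hsc))⟩
  · dsimp only [EpsStrong.bisect]
    split_ifs with hm
    · exact ⟨hm, (pathMax_mono hw hsc hl).trans h.upper.2⟩
    · exact ⟨h.xs ▸ max_le (le_pathMax (hw.mono hl) (left_mem_Icc.2 hsc))
        (le_pathMax (hw.mono hl) (right_mem_Icc.2 hsc)), (not_le.1 hm).le⟩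
  · dsimp only [EpsStrong.bisect]
    split_ifs with hm
    · exact ⟨h.lower.1.trans (pathMin_anti hw hct hr), hm⟩
    · exact ⟨(not_le.1 hm).le, h.xt ▸ le_min (pathMin_le (hw.mono hr) (left_mem_Icc.2 hct))
        (pathMin_le (hw.mono hr) (right_mem_Icc.2 hct))⟩
  · dsimp only [EpsStrong.bisect]
    split_ifs with hm
    · exact ⟨hm, (pathMax_mono hw hct hr).trans h.upper.2⟩
    · exact ⟨h.xt ▸ max_le (le_pathMax (hw.mono hr) (left_mem_Icc.2 hct))
        (le_pathMax (hw.mono hr) (right_mem_Icc.2 hct)), (not_le.1 hm).le⟩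

end Invariants

/-! ### Enclosure and width of the layers after `n` iterations -/

section Layers

variable {w : ℝ → ℝ} {L₀ U₀ : Layer}

lemma midpoint_dyadic (n i : ℕ) :
    ((i : ℝ) / 2 ^ n + ((i : ℝ) + 1) / 2 ^ n) / 2 = ((2 * i : ℕ) + 1) / 2 ^ (n + 1) := by
  push_cast
  rw [pow_succ]
  field_simp
  ring

lemma two_mul_dyadic (n i : ℕ) : (i : ℝ) / 2 ^ n = (2 * i : ℕ) / 2 ^ (n + 1) := by
  push_cast
  rw [pow_succ]
  field_simp

lemma half_sub_dyadic (n i : ℕ) :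
    (((i : ℝ) + 1) / 2 ^ n - i / 2 ^ n) / 2 = 1 / 2 ^ (n + 1) := by
  rw [pow_succ]
  field_simp
  ring

lemma layers_succ_even (n i : ℕ) : layers w L₀ U₀ (n + 1) (2 * i) =
    refine w (i / 2 ^ n) ((i / 2 ^ n + (i + 1) / 2 ^ n) / 2) (√(1 / 2 ^ (n + 1)))
      (bisect w (i / 2 ^ n) ((i + 1) / 2 ^ n) (layers w L₀ U₀ n i)).1 := by
  have h : 2 * i / 2 = i := by omega
  rw [layers]
  simp only [h, half_sub_dyadic, Nat.mul_mod_right, if_true]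

lemma layers_succ_odd (n i : ℕ) : layers w L₀ U₀ (n + 1) (2 * i + 1) =
    refine w ((i / 2 ^ n + (i + 1) / 2 ^ n) / 2) ((i + 1) / 2 ^ n) (√(1 / 2 ^ (n + 1)))
      (bisect w (i / 2 ^ n) ((i + 1) / 2 ^ n) (layers w L₀ U₀ n i)).2 := by
  have h : (2 * i + 1) / 2 = i := by omega
  have h' : ¬ (2 * i + 1) % 2 = 0 := by omega
  rw [layers]
  simp only [h, half_sub_dyadic, h', if_false]

lemma Icc_dyadic_subset {n j : ℕ} (hj : j < 2 ^ n) :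
    Icc ((j : ℝ) / 2 ^ n) (((j : ℝ) + 1) / 2 ^ n) ⊆ Icc 0 1 := by
  refine Icc_subset_Icc (by positivity) ?_
  rw [div_le_one (by positivity)]
  exact_mod_cast hj

lemma dyadic_le (n j : ℕ) : (j : ℝ) / 2 ^ n ≤ ((j : ℝ) + 1) / 2 ^ n := by
  gcongr
  linarith

lemma layers_encloses (hw : ContinuousOn w (Icc 0 1))
    (hL : pathMin w 0 1 ∈ Icc L₀.1 L₀.2) (hU : pathMax w 0 1 ∈ Icc U₀.1 U₀.2) (n : ℕ) :
    ∀ j : ℕ, j < 2 ^ n → Encloses w (j / 2 ^ n) ((j + 1) / 2 ^ n) (layers w L₀ U₀ n j) := by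
  induction n with
  | zero =>
    intro j hj
    obtain rfl : j = 0 := by simpa using hj
    exact ⟨by simp [layers], by simp [layers], by simpa [layers] using hL,
      by simpa [layers] using hU⟩
  | succ n ih =>
    intro j hj
    rcases Nat.even_or_odd' j with ⟨i, rfl | rfl⟩
    · have hi : i < 2 ^ n := by rw [pow_succ] at hj; omega
      rw [layers_succ_even, ← two_mul_dyadic, ← midpoint_dyadic]
      exact ((ih i hi).bisect (hw.mono (Icc_dyadic_subset hi)) (dyadic_le n i)).1.refine
    · have hi : i < 2 ^ n := by rw [pow_succ] at hj; omega
      have h1 : ((2 * i + 1 : ℕ) : ℝ) / 2 ^ (n + 1) =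
          ((i : ℝ) / 2 ^ n + ((i : ℝ) + 1) / 2 ^ n) / 2 := by
        rw [midpoint_dyadic]
        push_cast
        rfl
      have h2 : (((2 * i + 1 : ℕ) : ℝ) + 1) / 2 ^ (n + 1) = ((i : ℝ) + 1) / 2 ^ n := by
        push_cast
        rw [pow_succ]
        field_simp
        ring
      rw [layers_succ_odd, h1, h2]
      exact ((ih i hi).bisect (hw.mono (Icc_dyadic_subset hi)) (dyadic_le n i)).2.refine

/-- The width comes from the last refinement alone, hence `1 ≤ n`: the initial layers may be
arbitrarily wide. -/
lemma width_layers_le {n : ℕ} (hn : 1 ≤ n) (j : ℕ) :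
    (layers w L₀ U₀ n j).lower.width ≤ √(1 / 2 ^ n) ∧
      (layers w L₀ U₀ n j).upper.width ≤ √(1 / 2 ^ n) := by
  obtain ⟨n, rfl⟩ := Nat.exists_eq_add_of_le' hn
  have hδ : 0 < √(1 / 2 ^ (n + 1) : ℝ) := Real.sqrt_pos.2 (by positivity)
  rcases Nat.even_or_odd' j with ⟨i, rfl | rfl⟩
  · rw [layers_succ_even]
    exact ⟨width_refineUntil_le (width_refineLower _) hδ _,
      width_refineUntil_le (width_refineUpper _) hδ _⟩
  · rw [layers_succ_odd]
    exact ⟨width_refineUntil_le (width_refineLower _) hδ _,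
      width_refineUntil_le (width_refineUpper _) hδ _⟩

end Layers

/-! ### Measurability of the random layers -/

section Measurability

variable {Ω : Type*} [MeasurableSpace Ω] {P : Measure Ω} {X : ℝ → Ω → ℝ}

/-- All components of a random intersection layer are almost everywhere measurable. -/
structure AEMeasurableLayer (I : Ω → IntersectionLayer) (P : Measure Ω) : Prop where
  xs : AEMeasurable (fun ω => (I ω).xs) P
  xt : AEMeasurable (fun ω => (I ω).xt) P
  lower : AEMeasurable (fun ω => (I ω).lower) P
  upper : AEMeasurable (fun ω => (I ω).upper) P

/-- The set `{f ≤ g}` need not be measurable here, so the case distinction is made by a measurable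
function on a product space and then composed. -/
lemma aemeasurable_ite_le {β : Type*} [MeasurableSpace β] {f g : Ω → ℝ} {F G : Ω → β}
    (hf : AEMeasurable f P) (hg : AEMeasurable g P) (hF : AEMeasurable F P)
    (hG : AEMeasurable G P) : AEMeasurable (fun ω => if f ω ≤ g ω then F ω else G ω) P := by
  have h : Measurable fun p : (ℝ × ℝ) × (β × β) => if p.1.1 ≤ p.1.2 then p.2.1 else p.2.2 :=
    Measurable.ite (measurableSet_le (by fun_prop) (by fun_prop)) (by fun_prop) (by fun_prop)
  exact h.comp_aemeasurable ((hf.prodMk hg).prodMk (hF.prodMk hG))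

variable {s t : ℝ} {I : Ω → IntersectionLayer}

lemma AEMeasurableLayer.refine (hI : AEMeasurableLayer I P) (hst : s ≤ t)
    (hmeas : ∀ u ∈ Icc s t, AEMeasurable (X u) P)
    (hcont : ∀ᵐ ω ∂P, ContinuousOn (fun u => X u ω) (Icc s t)) {δ : ℝ} (hδ : 0 < δ) :
    AEMeasurableLayer (fun ω => refine (fun u => X u ω) s t δ (I ω)) P where
  xs := hI.xs
  xt := hI.xt
  lower := (measurable_refineUntil measurable_refineLower width_refineLower hδ).comp_aemeasurable
    ((aemeasurable_pathMin hst hmeas hcont).prodMk hI.lower)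
  upper := (measurable_refineUntil measurable_refineUpper width_refineUpper hδ).comp_aemeasurable
    ((aemeasurable_pathMax hst hmeas hcont).prodMk hI.upper)

lemma AEMeasurableLayer.bisect (hI : AEMeasurableLayer I P) (hst : s ≤ t)
    (hmeas : ∀ u ∈ Icc s t, AEMeasurable (X u) P)
    (hcont : ∀ᵐ ω ∂P, ContinuousOn (fun u => X u ω) (Icc s t)) :
    AEMeasurableLayer (fun ω => (bisect (fun u => X u ω) s t (I ω)).1) P ∧
      AEMeasurableLayer (fun ω => (bisect (fun u => X u ω) s t (I ω)).2) P := by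
  have hsc : s ≤ (s + t) / 2 := by linarith
  have hct : (s + t) / 2 ≤ t := by linarith
  have hl : Icc s ((s + t) / 2) ⊆ Icc s t := Icc_subset_Icc_right hct
  have hr : Icc ((s + t) / 2) t ⊆ Icc s t := Icc_subset_Icc_left hsc
  have hc : AEMeasurable (X ((s + t) / 2)) P := hmeas _ ⟨hsc, hct⟩
  have hLdn := hI.lower.fst
  have hLup := hI.lower.snd.min hc
  have hUdn := hI.upper.fst.max hc
  have hUup := hI.upper.snd
  have hcl := hcont.mono fun ω hω => hω.mono hl
  have hcr := hcont.mono fun ω hω => hω.mono hr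
  have hml := fun u hu => hmeas u (hl hu)
  have hmr := fun u hu => hmeas u (hr hu)
  exact ⟨⟨hI.xs, hc,
      aemeasurable_ite_le (aemeasurable_pathMin hsc hml hcl) hLup (hLdn.prodMk hLup)
        (hLup.prodMk (hI.xs.min hc)),
      aemeasurable_ite_le hUdn (aemeasurable_pathMax hsc hml hcl) (hUdn.prodMk hUup)
        ((hI.xs.max hc).prodMk hUdn)⟩,
    ⟨hc, hI.xt,
      aemeasurable_ite_le (aemeasurable_pathMin hct hmr hcr) hLup (hLdn.prodMk hLup)
        (hLup.prodMk (hc.min hI.xt)),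
      aemeasurable_ite_le hUdn (aemeasurable_pathMax hct hmr hcr) (hUdn.prodMk hUup)
        ((hc.max hI.xt).prodMk hUdn)⟩⟩

lemma aemeasurableLayer_layers (hmeas : ∀ u ∈ Icc (0 : ℝ) 1, AEMeasurable (X u) P)
    (hcont : ∀ᵐ ω ∂P, ContinuousOn (fun u => X u ω) (Icc 0 1)) {L₀ U₀ : Ω → Layer}
    (hL : AEMeasurable L₀ P) (hU : AEMeasurable U₀ P) (n : ℕ) :
    ∀ j < 2 ^ n, AEMeasurableLayer (fun ω => layers (fun u => X u ω) (L₀ ω) (U₀ ω) n j) P := by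
  induction n with
  | zero =>
    intro j _
    exact ⟨hmeas 0 (by simp), hmeas 1 (by simp), hL, hU⟩
  | succ n ih =>
    intro j hj
    have hδ : 0 < √(1 / 2 ^ (n + 1) : ℝ) := Real.sqrt_pos.2 (by positivity)
    obtain ⟨i, hij⟩ := Nat.even_or_odd' j
    have hi : i < 2 ^ n := by rw [pow_succ] at hj; omega
    have hsub := Icc_dyadic_subset hi
    have hst := dyadic_le n i
    have hb := (ih i hi).bisect hst (fun u hu => hmeas u (hsub hu))
      (hcont.mono fun ω hω => hω.mono hsub)
    rcases hij with rfl | rfl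
    · simp_rw [layers_succ_even]
      have hsub' : Icc ((i : ℝ) / 2 ^ n) (((i : ℝ) / 2 ^ n + ((i : ℝ) + 1) / 2 ^ n) / 2) ⊆
          Icc 0 1 := (Icc_subset_Icc_right (by linarith)).trans hsub
      exact hb.1.refine (by linarith) (fun u hu => hmeas u (hsub' hu))
        (hcont.mono fun ω hω => hω.mono hsub') hδ
    · simp_rw [layers_succ_odd]
      have hsub' : Icc (((i : ℝ) / 2 ^ n + ((i : ℝ) + 1) / 2 ^ n) / 2) (((i : ℝ) + 1) / 2 ^ n) ⊆
          Icc 0 1 := (Icc_subset_Icc_left (by linarith)).trans hsub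
      exact hb.2.refine (by linarith) (fun u hu => hmeas u (hsub' hu))
        (hcont.mono fun ω hω => hω.mono hsub') hδ

end Measurability

/-! ### The distance as a finite sum -/

section Distance

variable {w : ℝ → ℝ} {L₀ U₀ : Layer}

lemma sum_indicator_dyadic (c : ℕ → ℝ) {n k : ℕ} (hk : k < 2 ^ n) {u : ℝ}
    (hu : u ∈ Ioc ((k : ℝ) / 2 ^ n) (((k : ℝ) + 1) / 2 ^ n)) :
    ∑ j ∈ Finset.range (2 ^ n), (Ioc ((j : ℝ) / 2 ^ n) (((j : ℝ) + 1) / 2 ^ n)).indicator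
      (fun _ => c j) u = c k := by
  rw [Finset.sum_eq_single_of_mem k (Finset.mem_range.2 hk), indicator_of_mem hu]
  intro j _ hjk
  refine indicator_of_notMem (fun hj => hjk ?_) _
  have h1 : (j : ℝ) < k + 1 := (div_lt_div_iff_of_pos_right (by positivity)).1
    (hj.1.trans_le hu.2)
  have h2 : (k : ℝ) < j + 1 := (div_lt_div_iff_of_pos_right (by positivity)).1
    (hu.1.trans_le hj.2)
  norm_cast at h1 h2
  omega

/-- Both processes are constant on each half-open dyadic interval, and these intervals partition
`(0, 1]`. -/
lemma distL1_eq_sum (n : ℕ) : distL1 w L₀ U₀ n = ∑ j ∈ Finset.range (2 ^ n),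
    1 / 2 ^ n * |(layers w L₀ U₀ n j).upper.2 - (layers w L₀ U₀ n j).lower.1| := by
  set f : ℝ → ℝ := fun u => |upperProc w L₀ U₀ n u - lowerProc w L₀ U₀ n u| with hf
  set c : ℕ → ℝ := fun j => |(layers w L₀ U₀ n j).upper.2 - (layers w L₀ U₀ n j).lower.1| with hc
  have hfc : ∀ k : ℕ, k < 2 ^ n →
      EqOn (fun _ => c k) f (Ioc ((k : ℝ) / 2 ^ n) (((k : ℝ) + 1) / 2 ^ n)) := by
    intro k hk u hu
    simp only [hf, hc, upperProc, lowerProc]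
    rw [sum_indicator_dyadic _ hk hu, sum_indicator_dyadic _ hk hu]
  have hint : ∀ k : ℕ, k < 2 ^ n → IntervalIntegrable f volume ((k : ℝ) / 2 ^ n)
      (((k + 1 : ℕ) : ℝ) / 2 ^ n) := by
    intro k hk
    push_cast
    rw [intervalIntegrable_iff_integrableOn_Ioc_of_le (dyadic_le n k)]
    exact IntegrableOn.congr_fun (by simp) (hfc k hk) measurableSet_Ioc
  have hsum := intervalIntegral.sum_integral_adjacent_intervals
    (a := fun k : ℕ => (k : ℝ) / 2 ^ n) hint
  have h1 : ((2 ^ n : ℕ) : ℝ) / 2 ^ n = 1 := by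
    push_cast
    exact div_self (by positivity)
  rw [h1] at hsum
  simp only [Nat.cast_zero, zero_div] at hsum
  rw [distL1, ← hsum]
  refine Finset.sum_congr rfl fun k hk => ?_
  push_cast
  rw [intervalIntegral.integral_of_le (dyadic_le n k),
    ← setIntegral_congr_fun measurableSet_Ioc (hfc k (Finset.mem_range.1 hk)),
    ← intervalIntegral.integral_of_le (dyadic_le n k), intervalIntegral.integral_const,
    smul_eq_mul]
  congr 1
  ring

end Distance

end EpsStrong

namespace EpsStrong

lemma distL1_nonneg (w : ℝ → ℝ) (L₀ U₀ : Layer) (n : ℕ) : 0 ≤ distL1 w L₀ U₀ n := by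
  rw [distL1_eq_sum]
  positivity

/-- The gap between the dominating processes on a dyadic interval, in terms of a bound `g` on the
oscillation of the path there. -/
lemma ofReal_abs_layers_sub_le {w : ℝ → ℝ} {L₀ U₀ : Layer} (hw : ContinuousOn w (Icc 0 1))
    (hL : pathMin w 0 1 ∈ Icc L₀.1 L₀.2) (hU : pathMax w 0 1 ∈ Icc U₀.1 U₀.2) {n : ℕ}
    (hn : 1 ≤ n) {j : ℕ} (hj : j < 2 ^ n) {g : ENNReal}
    (hg : ∀ u ∈ Icc ((j : ℝ) / 2 ^ n) (((j : ℝ) + 1) / 2 ^ n),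
      ENNReal.ofReal |w u - w (j / 2 ^ n)| ≤ g) :
    ENNReal.ofReal |(layers w L₀ U₀ n j).upper.2 - (layers w L₀ U₀ n j).lower.1| ≤
      2 * g + ENNReal.ofReal (2 * √(1 / 2 ^ n)) := by
  have hw' := hw.mono (Icc_dyadic_subset hj)
  have henc := layers_encloses hw hL hU n j hj
  have hwid := width_layers_le (w := w) (L₀ := L₀) (U₀ := U₀) hn j
  unfold Layer.width at hwid
  obtain ⟨u, hu, hu'⟩ := exists_eq_pathMax hw' (dyadic_le n j)
  obtain ⟨v, hv, hv'⟩ := exists_eq_pathMin hw' (dyadic_le n j)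
  have hlu := pathMin_le hw' hu
  have h1 := henc.lower
  have h2 := henc.upper
  rw [← hu'] at h2
  rw [← hv'] at h1 hlu
  set a := w (j / 2 ^ n)
  -- From `L↓ ≤ m ≤ M ≤ U↑` the gap is nonnegative, and it exceeds `M - m` by at most the two layer
  -- widths. The oscillation is measured from the value `a` at the left endpoint.
  have h3 : |(layers w L₀ U₀ n j).upper.2 - (layers w L₀ U₀ n j).lower.1| ≤
      |w u - a| + |w v - a| + 2 * √(1 / 2 ^ n) := by
    rw [abs_of_nonneg (by linarith [h1.1, h2.2])]
    have := le_abs_self (w u - a)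
    have := neg_abs_le (w v - a)
    linarith [h1.2, h2.1, hwid.1, hwid.2]
  refine (ENNReal.ofReal_le_ofReal h3).trans ?_
  rw [ENNReal.ofReal_add (by positivity) (by positivity),
    ENNReal.ofReal_add (by positivity) (by positivity), two_mul g]
  exact add_le_add_left (add_le_add (hg u hu) (hg v hv)) _

/-! ### The expected distance -/

section Expectation

variable {Ω : Type*} [MeasurableSpace Ω] {P : Measure Ω} {X : ℝ → Ω → ℝ} {x y : ℝ}
  {L₀ U₀ : Ω → Layer}

lemma aemeasurable_distL1 (hmeas : ∀ u ∈ Icc (0 : ℝ) 1, AEMeasurable (X u) P)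
    (hcont : ∀ᵐ ω ∂P, ContinuousOn (fun u => X u ω) (Icc 0 1))
    (hL : AEMeasurable L₀ P) (hU : AEMeasurable U₀ P) (n : ℕ) :
    AEMeasurable (fun ω => distL1 (fun u => X u ω) (L₀ ω) (U₀ ω) n) P := by
  simp_rw [distL1_eq_sum]
  refine Finset.aemeasurable_fun_sum _ fun j hj => AEMeasurable.const_mul ?_ _
  have h := aemeasurableLayer_layers hmeas hcont hL hU n j (Finset.mem_range.1 hj)
  exact continuous_abs.measurable.comp_aemeasurable (h.upper.snd.sub h.lower.fst)

/-- The expected `L¹` distance after `n ≥ 1` iterations is at most a constant times `2^(-n/2)`. -/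
lemma IsBrownianBridge.exists_lintegral_distL1_le [IsProbabilityMeasure P]
    (hX : IsBrownianBridge X x y P)
    (hL : ∀ᵐ ω ∂P, pathMin (fun u => X u ω) 0 1 ∈ Icc (L₀ ω).1 (L₀ ω).2)
    (hU : ∀ᵐ ω ∂P, pathMax (fun u => X u ω) 0 1 ∈ Icc (U₀ ω).1 (U₀ ω).2) :
    ∃ C : ℝ, 0 ≤ C ∧ ∀ n : ℕ, 1 ≤ n →
      ∫⁻ ω, ENNReal.ofReal (distL1 (fun u => X u ω) (L₀ ω) (U₀ ω) n) ∂P ≤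
        ENNReal.ofReal (C * √(1 / 2 ^ n)) := by
  obtain ⟨K, hK, hmom⟩ := hX.exists_lintegral_sub_pow_four_le
  obtain ⟨C, hC, hosc⟩ := exists_lintegral_oscillation_le hK (fun u hu => hX.aemeasurable hu)
    hX.continuous hmom
  refine ⟨2 * C + 2, by positivity, fun n hn => ?_⟩
  have hG : ∀ j : ℕ, ∃ G : Ω → ENNReal, j < 2 ^ n →
      AEMeasurable G P ∧ ∫⁻ ω, G ω ∂P ≤ ENNReal.ofReal (C * √(1 / 2 ^ n)) ∧
      ∀ᵐ ω ∂P, ∀ u ∈ Icc ((j : ℝ) / 2 ^ n) (((j : ℝ) + 1) / 2 ^ n),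
        ENNReal.ofReal |X u ω - X (j / 2 ^ n) ω| ≤ G ω := by
    -- Indices `j ≥ 2^n` get the dummy value `0`, so that `choose` yields a family indexed by all of
    -- `ℕ`.
    intro j
    by_cases hj : j < 2 ^ n
    · have hend : ((j : ℝ) + 1) / 2 ^ n ≤ 1 := (Icc_dyadic_subset hj
        (right_mem_Icc.2 (dyadic_le n j))).2
      rw [add_div] at hend
      obtain ⟨G, h0, h1, h2⟩ := hosc (j / 2 ^ n) (1 / 2 ^ n) (by positivity) (by positivity) hend
      rw [← add_div] at h2
      exact ⟨G, fun _ => ⟨h0, h1, h2⟩⟩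
    · exact ⟨0, fun h => absurd h hj⟩
  choose G hG using hG
  set F : ℕ → Ω → ENNReal := fun j ω =>
    ENNReal.ofReal (1 / 2 ^ n) * (2 * G j ω + ENNReal.ofReal (2 * √(1 / 2 ^ n))) with hF
  have hFmeas : ∀ j ∈ Finset.range (2 ^ n), AEMeasurable (F j) P := fun j hj =>
    (((hG j (Finset.mem_range.1 hj)).1.const_mul 2).add_const _).const_mul _
  have hFint : ∀ j ∈ Finset.range (2 ^ n), ∫⁻ ω, F j ω ∂P ≤
      ENNReal.ofReal (1 / 2 ^ n * ((2 * C + 2) * √(1 / 2 ^ n))) := by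
    intro j hj
    obtain ⟨h0, h1, -⟩ := hG j (Finset.mem_range.1 hj)
    simp only [hF]
    rw [lintegral_const_mul' _ _ ENNReal.ofReal_ne_top, lintegral_add_right _ measurable_const,
      lintegral_const_mul' _ _ (by simp), lintegral_const, measure_univ, mul_one,
      ENNReal.ofReal_mul (p := 1 / 2 ^ n) (by positivity)]
    gcongr
    calc 2 * ∫⁻ ω, G j ω ∂P + ENNReal.ofReal (2 * √(1 / 2 ^ n))
        ≤ 2 * ENNReal.ofReal (C * √(1 / 2 ^ n)) + ENNReal.ofReal (2 * √(1 / 2 ^ n)) := by gcongr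
      _ = ENNReal.ofReal ((2 * C + 2) * √(1 / 2 ^ n)) := by
        rw [two_mul, ← ENNReal.ofReal_add (by positivity) (by positivity),
          ← ENNReal.ofReal_add (by positivity) (by positivity)]
        congr 1
        ring
  have hle : ∀ᵐ ω ∂P, ENNReal.ofReal (distL1 (fun u => X u ω) (L₀ ω) (U₀ ω) n) ≤
      ∑ j ∈ Finset.range (2 ^ n), F j ω := by
    have hall : ∀ᵐ ω ∂P, ∀ j : ℕ, j < 2 ^ n →
        ∀ u ∈ Icc ((j : ℝ) / 2 ^ n) (((j : ℝ) + 1) / 2 ^ n),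
          ENNReal.ofReal |X u ω - X (j / 2 ^ n) ω| ≤ G j ω := by
      refine ae_all_iff.2 fun j => ?_
      by_cases hj : j < 2 ^ n
      · filter_upwards [(hG j hj).2.2] with ω hω _ using hω
      · exact Eventually.of_forall fun ω h => absurd h hj
    filter_upwards [hall, hX.continuous, hL, hU] with ω hω hc hl hu
    rw [distL1_eq_sum, ENNReal.ofReal_sum_of_nonneg fun j _ => by positivity]
    refine Finset.sum_le_sum fun j hj => ?_
    rw [ENNReal.ofReal_mul (by positivity)]
    have := ofReal_abs_layers_sub_le hc hl hu hn (Finset.mem_range.1 hj)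
      (hω j (Finset.mem_range.1 hj))
    simp only [hF]
    gcongr
  calc ∫⁻ ω, ENNReal.ofReal (distL1 (fun u => X u ω) (L₀ ω) (U₀ ω) n) ∂P
      ≤ ∫⁻ ω, ∑ j ∈ Finset.range (2 ^ n), F j ω ∂P := lintegral_mono_ae hle
    _ = ∑ j ∈ Finset.range (2 ^ n), ∫⁻ ω, F j ω ∂P := lintegral_finsetSum' _ hFmeas
    _ ≤ ∑ j ∈ Finset.range (2 ^ n),
          ENNReal.ofReal (1 / 2 ^ n * ((2 * C + 2) * √(1 / 2 ^ n))) := Finset.sum_le_sum hFint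
    -- There are `2^n` intervals of weight `2^(-n)` each.
    _ = ENNReal.ofReal ((2 * C + 2) * √(1 / 2 ^ n)) := by
      rw [Finset.sum_const, Finset.card_range, nsmul_eq_mul, ← ENNReal.ofReal_natCast,
        ← ENNReal.ofReal_mul (by positivity), ← mul_assoc]
      congr 1
      push_cast
      rw [mul_one_div_cancel (by positivity), one_mul]

end Expectation

end EpsStrong

theorem mainTheorem2 {Ω : Type*} [MeasurableSpace Ω] (P : Measure Ω) [IsProbabilityMeasure P]
    (x y : ℝ) (X : ℝ → Ω → ℝ) (hX : EpsStrong.IsBrownianBridge X x y P)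
    (L₀ U₀ : Ω → EpsStrong.Layer) (hLmeas : AEMeasurable L₀ P) (hUmeas : AEMeasurable U₀ P)
    (hL : ∀ᵐ ω ∂P, EpsStrong.pathMin (fun u => X u ω) 0 1 ∈ Icc (L₀ ω).1 (L₀ ω).2)
    (hU : ∀ᵐ ω ∂P, EpsStrong.pathMax (fun u => X u ω) 0 1 ∈ Icc (U₀ ω).1 (U₀ ω).2) :
    (∀ n : ℕ, 1 ≤ n →
      Integrable (fun ω => EpsStrong.distL1 (fun u => X u ω) (L₀ ω) (U₀ ω) n) P) ∧
    (fun n : ℕ => (2 : ℝ) ^ ((n : ℝ) / 2) *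
        ∫ ω, EpsStrong.distL1 (fun u => X u ω) (L₀ ω) (U₀ ω) n ∂P)
      =O[atTop] (fun _ => (1 : ℝ)) := by
  obtain ⟨C, hC, hbound⟩ := hX.exists_lintegral_distL1_le hL hU
  have hmeas : ∀ n, AEStronglyMeasurable
      (fun ω => EpsStrong.distL1 (fun u => X u ω) (L₀ ω) (U₀ ω) n) P := fun n =>
    (EpsStrong.aemeasurable_distL1 (fun u hu => hX.aemeasurable hu) hX.continuous
      hLmeas hUmeas n).aestronglyMeasurable
  have hnonneg : ∀ n, 0 ≤ᵐ[P] fun ω => EpsStrong.distL1 (fun u => X u ω) (L₀ ω) (U₀ ω) n :=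
    fun n => Eventually.of_forall fun ω => EpsStrong.distL1_nonneg _ _ _ n
  refine ⟨fun n hn => ⟨hmeas n, ?_⟩, IsBigO.of_bound C ?_⟩
  -- The moment bound also gives integrability.
  · rw [hasFiniteIntegral_iff_ofReal (hnonneg n)]
    exact (hbound n hn).trans_lt ENNReal.ofReal_lt_top
  · filter_upwards [eventually_ge_atTop 1] with n hn
    have hint : ∫ ω, EpsStrong.distL1 (fun u => X u ω) (L₀ ω) (U₀ ω) n ∂P ≤
        C * √(1 / 2 ^ n) := by
      rw [integral_eq_lintegral_of_nonneg_ae (hnonneg n) (hmeas n)]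
      exact ENNReal.toReal_le_of_le_ofReal (by positivity) (hbound n hn)
    have h0 : 0 ≤ ∫ ω, EpsStrong.distL1 (fun u => X u ω) (L₀ ω) (U₀ ω) n ∂P :=
      integral_nonneg_of_ae (hnonneg n)
    have h2 : (2 : ℝ) ^ ((n : ℝ) / 2) = √(2 ^ n) := by
      rw [Real.sqrt_eq_rpow, ← Real.rpow_natCast, ← Real.rpow_mul (by norm_num)]
      congr 1
      ring
    rw [Real.norm_of_nonneg (by positivity), norm_one, mul_one, h2]
    calc √(2 ^ n) * ∫ ω, EpsStrong.distL1 (fun u => X u ω) (L₀ ω) (U₀ ω) n ∂P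
        ≤ √(2 ^ n) * (C * √(1 / 2 ^ n)) := by gcongr
      _ = C * (√(2 ^ n) * √(1 / 2 ^ n)) := by ring
      _ = C := by
        rw [← Real.sqrt_mul (by positivity), mul_one_div_cancel (by positivity), Real.sqrt_one,
          mul_one]
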